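/- Let $2\le L<M$ and let $P_1,\dots,P_L$ be probability distributions on an arbitrary measurable space that are jointly irreducible, i.e. whenever $\sum_i\gamma_iP_i$ with $\gamma\in\mathbb R^L$ is a probability distribution, then $\gamma_i\ge 0$ for all $i$. Let $\Pi=(\pi_{ij})$ be an $M\times L$ matrix with $\pi_{ij}\ge0$ and $\sum_j\pi_{ij}=1$ for all $i$, which has full rank $L$, and let $\tilde P_i=\sum_{j=1}^L\pi_{ij}P_j$ for $i=1,\dots,M$. For distributions $F_0,F_1,\dots,F_K$ let $\kappa^*(F_0\mid F_1,\dots,F_K)$ be the maximum of $\sum_i\nu_i$ over all $\nu_i\ge0$ with $\sum_i\nu_i\le1$ for which there is a distribution $G$ with $F_0=(1-\sum_i\nu_i)G+\sum_i\nu_iF_i$; a multi-sample residue of $F_0$ with respect to $F_1,\dots,F_K$ is $(F_0-\sum_i\nu_iF_i)/(1-\sum_i\nu_i)$ for some maximizing $\nu$, and $\mathrm{Residue}(F_0\mid F_1)=\frac{F_0-\kappa F_1}{1-\kappa}$ with $\kappa=\kappa^*(F_0\mid F_1)$. A uniformly distributed element of the convex hull $\mathrm{co}$ of finitely many distributions has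 as its law the normalized Lebesgue measure on that polytope, of the dimension of its affine hull. The randomized algorithm $\mathrm{Demix}(S_1,\dots,S_K)$, $K\ge2$, is defined recursively. For $K=2$ it returns $(\mathrm{Residue}(S_1\mid S_2),\mathrm{Residue}(S_2\mid S_1))$. For $K>2$ it draws $Q$ uniformly from $\mathrm{co}(S_2,\dots,S_K)$ (with fresh randomness); for $n=2,3,\dots$ it computes $R_i=\mathrm{Residue}(\frac1nS_i+\frac{n-1}nQ\mid S_1)$, $i=2,\dots,K$, and stops at the first $n$ such that $\kappa^*(R_i\mid R_j)>0$ for all $i\ne j$; with these $R_i$ it computes $(Q_1,\dots,Q_{K-1})=\mathrm{Demix}(R_2,\dots,R_K)$ and returns $(Q_1,\dots,Q_{K-1},Q_K)$, where $Q_K$ is a multi-sample residue of $\frac1K\sum_{i=1}^KS_i$ with respect to $Q_1,\dots,Q_{K-1}$ (the maximizing $\nu$ being selected by an arbitrary fixed rule). The algorithm $\mathrm{NonSquareDemix}(\tilde P_1,\dots,\tilde P_M)$ draws $R_1,\dots,R_L$ independently and uniformly from $\mathrm{co}(\tilde P_1,\dots,\tilde P_M)$ and returns $\mathrm{Demix}(R_1,\dots,R_L)$.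 Then, with probability $1$, $\mathrm{NonSquareDemix}(\tilde P_1,\dots,\tilde P_M)$ terminates and returns $(Q_1,\dots,Q_L)$ that is a permutation of $(P_1,\dots,P_L)$. -/

import Mathlib

open MeasureTheory
open scoped ENNReal

noncomputable section

namespace Demixing

/-! ### Uniform random elements of the convex hull of finitely many points -/

section Uniform

variable {V : Type*} [AddCommGroup V] [Module ℝ V] {ι : Type*} [Finite ι]

/-- The dimension of the affine hull of the points `S i`. -/
abbrev hullDim (S : ι → V) : ℕ := Module.finrank ℝ (vectorSpan ℝ (Set.range S))

/-- A choice of affine coordinates on the affine hull of the points `S i`: the point with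
coordinate vector `t`, with respect to some origin among the `S i` and some basis of the
direction of the affine hull. -/
def hullPoint (S : ι → V) (t : Fin (hullDim S) → ℝ) : V :=
  ((Module.finBasis ℝ (vectorSpan ℝ (Set.range S))).equivFun.symm t : V) +
    Classical.epsilon (fun p : V => p ∈ Set.range S)

/-- The uniform distribution on the convex hull `co {S i}`, in the coordinates `hullPoint S`:
Lebesgue measure conditioned on (restricted to and normalized on) the coordinate vectors of
points of the convex hull. If `t` has law `hullLaw S`, then `hullPoint S t` is a uniformly
distributed element of `co {S i}`. By `lintegral_hullPoint` below, its law does not depend on the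
coordinates. -/
def hullLaw (S : ι → V) : Measure (Fin (hullDim S) → ℝ) :=
  ProbabilityTheory.cond volume (hullPoint S ⁻¹' convexHull ℝ (Set.range S))

/-- The expectation of `f X`, for `X` uniformly distributed on the convex hull of the `S i`, may
be computed in any affine coordinates `t ↦ T t + q` on the affine hull. -/
theorem lintegral_hullPoint [Nonempty ι] (S : ι → V) {κ : Type*} [Fintype κ]
    (T : (κ → ℝ) ≃ₗ[ℝ] vectorSpan ℝ (Set.range S)) (q : V)
    (hq : q ∈ affineSpan ℝ (Set.range S)) (f : V → ℝ≥0∞) :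
    ∫⁻ t, f (hullPoint S t) ∂hullLaw S =
      ∫⁻ t, f ((T t : V) + q) ∂ProbabilityTheory.cond volume
        ((fun t => (T t : V) + q) ⁻¹' convexHull ℝ (Set.range S)) := by
  classical
  set b := (Module.finBasis ℝ (vectorSpan ℝ (Set.range S))).equivFun with hb
  set p := Classical.epsilon (fun p : V => p ∈ Set.range S) with hp
  have hpS : p ∈ Set.range S :=
    Classical.epsilon_spec (p := fun p : V => p ∈ Set.range S) (Set.range_nonempty S)
  have hqp : q - p ∈ vectorSpan ℝ (Set.range S) := by
    have h := AffineSubspace.vsub_mem_direction hq (subset_affineSpan ℝ _ hpS)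
    rwa [direction_affineSpan] at h
  set c : Fin (hullDim S) → ℝ := b ⟨q - p, hqp⟩ with hc
  let A : (κ → ℝ) ≃L[ℝ] (Fin (hullDim S) → ℝ) := (T.trans b).toContinuousLinearEquiv
  let e : (κ → ℝ) ≃ₜ (Fin (hullDim S) → ℝ) := A.toHomeomorph.trans (Homeomorph.addRight c)
  have he : ∀ t, hullPoint S (e t) = (T t : V) + q := by
    intro t
    have h1 : e t = b (T t) + b ⟨q - p, hqp⟩ := rfl
    have h2 : hullPoint S (e t) = (b.symm (e t) : V) + p := rfl
    rw [h2, h1, ← map_add, LinearEquiv.symm_apply_apply]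
    simp [add_assoc]
  have hmap : ∃ a : ℝ≥0∞, a ≠ 0 ∧ a ≠ ∞ ∧
      Measure.map e (volume : Measure (κ → ℝ)) = a • volume := by
    have : (Measure.map A (volume : Measure (κ → ℝ))).IsAddHaarMeasure :=
      A.isAddHaarMeasure_map volume
    have h := Measure.isAddLeftInvariant_eq_smul (Measure.map A (volume : Measure (κ → ℝ)))
      (volume : Measure (Fin (hullDim S) → ℝ))
    have h0 := Measure.addHaarScalarFactor_pos_of_isAddHaarMeasure
      (Measure.map A (volume : Measure (κ → ℝ))) (volume : Measure (Fin (hullDim S) → ℝ))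
    set a := (Measure.map A (volume : Measure (κ → ℝ))).addHaarScalarFactor
      (volume : Measure (Fin (hullDim S) → ℝ))
    refine ⟨(a : ℝ≥0∞), by exact_mod_cast h0.ne', ENNReal.coe_ne_top, ?_⟩
    have h2 : Measure.map e (volume : Measure (κ → ℝ)) =
        Measure.map (fun x => x + c) (Measure.map A volume) := by
      rw [Measure.map_map (by fun_prop) A.continuous.measurable]
      rfl
    rw [h2, h, Measure.map_smul, map_add_right_eq_self]
    rfl
  obtain ⟨a, ha0, hatop, ha⟩ := hmap
  set B := hullPoint S ⁻¹' convexHull ℝ (Set.range S) with hB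
  have hpre : (fun t => (T t : V) + q) ⁻¹' convexHull ℝ (Set.range S) = e ⁻¹' B := by
    ext t
    simp only [Set.mem_preimage, hB, he]
  have hlaw : hullLaw S = Measure.map e.toMeasurableEquiv (ProbabilityTheory.cond volume (e ⁻¹' B)) := by
    have h1 : (Measure.map e.toMeasurableEquiv (volume : Measure (κ → ℝ))) = a • volume := ha
    have h2 : volume (e ⁻¹' B) = a * volume B := by
      have := congrArg (fun m => m B) h1
      rw [MeasurableEquiv.map_apply] at this
      exact this
    unfold hullLaw ProbabilityTheory.cond
    rw [Measure.map_smul, h2]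
    have h3 : Measure.map e.toMeasurableEquiv (volume.restrict (e ⁻¹' B)) =
        a • volume.restrict B := by
      have := e.toMeasurableEquiv.restrict_map (volume : Measure (κ → ℝ)) B
      rw [h1, Measure.restrict_smul] at this
      exact this.symm
    rw [h3, smul_smul, ENNReal.mul_inv (Or.inl ha0) (Or.inl hatop), mul_comm a⁻¹, mul_assoc,
      ENNReal.inv_mul_cancel ha0 hatop, mul_one]
  rw [hpre, hlaw, lintegral_map_equiv]
  refine lintegral_congr fun t => ?_
  rw [← he]
  rfl

/-- `hullLaw S` is a probability measure. -/
theorem isProbabilityMeasure_hullLaw [Nonempty ι] (S : ι → V) :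
    IsProbabilityMeasure (hullLaw S) := by
  classical
  set b := (Module.finBasis ℝ (vectorSpan ℝ (Set.range S))).equivFun with hb
  set p := Classical.epsilon (fun p : V => p ∈ Set.range S) with hp
  have hpS : p ∈ Set.range S :=
    Classical.epsilon_spec (p := fun p : V => p ∈ Set.range S) (Set.range_nonempty S)
  let A : (Fin (hullDim S) → ℝ) →ᵃ[ℝ] V :=
    ((vectorSpan ℝ (Set.range S)).subtype ∘ₗ b.symm.toLinearMap).toAffineMap +
      AffineMap.const ℝ _ p
  have hA : ∀ t, hullPoint S t = A t := fun t => rfl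
  have hA' : ∀ t, A t = (b.symm t : V) + p := fun t => rfl
  have hinj : Function.Injective A := by
    intro x y hxy
    rw [hA', hA', add_left_inj] at hxy
    exact b.symm.injective (Subtype.ext hxy)
  have hmem : ∀ i, S i - p ∈ vectorSpan ℝ (Set.range S) := fun i =>
    vsub_mem_vectorSpan ℝ (Set.mem_range_self i) hpS
  let s : ι → (Fin (hullDim S) → ℝ) := fun i => b ⟨S i - p, hmem i⟩
  have hs : ∀ i, A (s i) = S i := by
    intro i
    rw [hA']
    simp [s]
  have himg : A '' Set.range s = Set.range S := by
    rw [← Set.range_comp]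
    exact congrArg Set.range (funext hs)
  have hpre : hullPoint S ⁻¹' convexHull ℝ (Set.range S) = convexHull ℝ (Set.range s) := by
    have h1 : hullPoint S = A := funext hA
    rw [h1, ← himg, ← AffineMap.image_convexHull, Set.preimage_image_eq _ hinj]
  have htop : affineSpan ℝ (Set.range s) = ⊤ := by
    rw [eq_top_iff]
    intro x _
    have h1 : A x ∈ affineSpan ℝ (Set.range S) := by
      rw [hA']
      have := AffineSubspace.vadd_mem_of_mem_direction
        (s := affineSpan ℝ (Set.range S)) (v := (b.symm x : V))
        (by rw [direction_affineSpan]; exact (b.symm x).2) (subset_affineSpan ℝ _ hpS)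
      simpa using this
    rw [← himg, ← AffineSubspace.map_span] at h1
    obtain ⟨y, hy, hyx⟩ := h1
    rwa [← hinj hyx]
  have hint : (interior (convexHull ℝ (Set.range s))).Nonempty :=
    interior_convexHull_nonempty_iff_affineSpan_eq_top.2 htop
  have hcpt : IsCompact (convexHull ℝ (Set.range s)) :=
    (Set.finite_range s).isCompact_convexHull ℝ
  unfold hullLaw
  rw [hpre]
  refine ProbabilityTheory.cond_isProbabilityMeasure_of_finite ?_ hcpt.measure_lt_top.ne
  exact (Measure.measure_pos_of_nonempty_interior volume hint).ne'

end Uniform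

/-! ### Distributions, joint irreducibility, `κ*` and residues -/

section Algorithm

variable {𝒳 : Type*} [MeasurableSpace 𝒳]

/-- A signed measure that is a probability distribution. -/
def IsDistribution (F : SignedMeasure 𝒳) : Prop :=
  0 ≤ F ∧ F Set.univ = 1

/-- `P₁, …, P_L` are jointly irreducible: every distribution in their linear span is a linear
combination with nonnegative coefficients only. -/
def JointlyIrreducible {L : ℕ} (P : Fin L → SignedMeasure 𝒳) : Prop :=
  ∀ γ : Fin L → ℝ, IsDistribution (∑ i, γ i • P i) → ∀ i, 0 ≤ γ i

/-- `κ*(F₀ | F₁)`, the largest `κ ∈ [0,1]` such that `F₀ = (1 - κ) G + κ F₁` for some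
distribution `G`. -/
def kappa (F₀ F₁ : SignedMeasure 𝒳) : ℝ :=
  sSup {κ : ℝ | κ ∈ Set.Icc (0 : ℝ) 1 ∧
    ∃ G : SignedMeasure 𝒳, IsDistribution G ∧ F₀ = (1 - κ) • G + κ • F₁}

/-- `Residue(F₀ | F₁)`. -/
def residue (F₀ F₁ : SignedMeasure 𝒳) : SignedMeasure 𝒳 :=
  (1 - kappa F₀ F₁)⁻¹ • (F₀ - kappa F₀ F₁ • F₁)

/-- The feasible weight vectors in the definition of `κ*(F₀ | F₁, …, F_K)`. -/
def IsFeasible {K : ℕ} (F₀ : SignedMeasure 𝒳) (F : Fin K → SignedMeasure 𝒳)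
    (ν : Fin K → ℝ) : Prop :=
  (∀ i, 0 ≤ ν i) ∧ ∑ i, ν i ≤ 1 ∧
    ∃ G : SignedMeasure 𝒳, IsDistribution G ∧ F₀ = (1 - ∑ i, ν i) • G + ∑ i, ν i • F i

/-- `ν` achieves the maximum in `κ*(F₀ | F₁, …, F_K)`. -/
def IsMaximizer {K : ℕ} (F₀ : SignedMeasure 𝒳) (F : Fin K → SignedMeasure 𝒳)
    (ν : Fin K → ℝ) : Prop :=
  IsFeasible F₀ F ν ∧ ∀ ν' : Fin K → ℝ, IsFeasible F₀ F ν' → ∑ i, ν' i ≤ ∑ i, ν i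

variable (𝒳) in
/-- A rule that selects, for every `F₀` and `F₁, …, F_K`, weights achieving the maximum in
`κ*(F₀ | F₁, …, F_K)` whenever there are such weights. -/
structure MaximizerRule where
  /-- the selected weights -/
  weights : ∀ {K : ℕ}, SignedMeasure 𝒳 → (Fin K → SignedMeasure 𝒳) → Fin K → ℝ
  isMaximizer : ∀ {K : ℕ} (F₀ : SignedMeasure 𝒳) (F : Fin K → SignedMeasure 𝒳),
    (∃ ν, IsMaximizer F₀ F ν) → IsMaximizer F₀ F (weights F₀ F)

/-- The multi-sample residue of `F₀` with respect to `F₁, …, F_K`, with the weights selected by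
the rule `ρ`. -/
def multiResidue (ρ : MaximizerRule 𝒳) {K : ℕ} (F₀ : SignedMeasure 𝒳)
    (F : Fin K → SignedMeasure 𝒳) : SignedMeasure 𝒳 :=
  (1 - ∑ i, ρ.weights F₀ F i)⁻¹ • (F₀ - ∑ i, ρ.weights F₀ F i • F i)

/-! ### The algorithms -/

/-- `FaceTest(Q₁, …, Q_K)` returns `1`. -/
def FaceTest {K : ℕ} (Q : Fin K → SignedMeasure 𝒳) : Prop :=
  ∀ i j, i ≠ j → 0 < kappa (Q i) (Q j)

/-- The distributions `R₂, …, R_K` computed from `S₁, …, S_K` and the random element `Q` in the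
pass of the while loop with counter `n`:
`R_i = Residue(S_i / n + (n - 1) / n * Q | S₁)`. -/
def loopResidues {k : ℕ} (S : Fin (k + 1) → SignedMeasure 𝒳) (Q : SignedMeasure 𝒳) (n : ℕ) :
    Fin k → SignedMeasure 𝒳 :=
  fun i => residue ((1 / (n : ℝ)) • S i.succ + (((n : ℝ) - 1) / n) • Q) (S 0)

open Classical in
/-- The probability, over the random draws made by the algorithm, that `Demix(S₁, …, S_K)`
terminates and returns an element of `E`.

* On fewer than two distributions the algorithm is not defined (and returns nothing).
* `Demix(S₁, S₂)` returns `(Residue(S₁ | S₂), Residue(S₂ | S₁))`.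
* For `K > 2`, `Q` is drawn uniformly from `co(S₂, …, S_K)`. The while loop is left at the first
  `n ≥ 2` such that `FaceTest(R₂, …, R_K)` returns `1`; if there is none, the algorithm does not
  terminate. Then `(Q₁, …, Q_{K-1})` is computed by `Demix(R₂, …, R_K)`, and
  `(Q₁, …, Q_{K-1}, Q_K)` is returned, where `Q_K` is the multi-sample residue of
  `(S₁ + ⋯ + S_K) / K` with respect to `Q₁, …, Q_{K-1}`. -/
def demixProb (ρ : MaximizerRule 𝒳) :
    (K : ℕ) → (Fin K → SignedMeasure 𝒳) → Set (Fin K → SignedMeasure 𝒳) → ℝ≥0∞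
  | 0, _, _ => 0
  | 1, _, _ => 0
  | 2, S, E => if ![residue (S 0) (S 1), residue (S 1) (S 0)] ∈ E then 1 else 0
  | k + 3, S, E =>
      ∫⁻ t,
        (let Q := hullPoint (Fin.tail S) t
         if h : ∃ n : ℕ, 2 ≤ n ∧ FaceTest (loopResidues S Q n) then
           demixProb ρ (k + 2) (loopResidues S Q (Nat.find h))
             {Q' | Fin.snoc Q' (multiResidue ρ ((1 / ((k : ℝ) + 3)) • ∑ i, S i) Q') ∈ E}
         else 0)
      ∂hullLaw (Fin.tail S)

/-- The probability that `NonSquareDemix(P̃₁, …, P̃_M)` terminates and returns an element of `E`: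
`R₁, …, R_L` are drawn independently and uniformly from `co(P̃₁, …, P̃_M)`, and
`Demix(R₁, …, R_L)` is returned. -/
def nonSquareDemixProb (ρ : MaximizerRule 𝒳) (L : ℕ) {M : ℕ} (S : Fin M → SignedMeasure 𝒳)
    (E : Set (Fin L → SignedMeasure 𝒳)) : ℝ≥0∞ :=
  ∫⁻ t : Fin L → (Fin (hullDim S) → ℝ), demixProb ρ L (fun i => hullPoint S (t i)) E
    ∂Measure.pi (fun _ => hullLaw S)

end Algorithm

end Demixing

end

/-! Joint irreducibility makes the `P j` linearly independent and identifies the distributions in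
their span with the standard simplex (`JointlyIrreducible.isSimplexParam`), so everything becomes
geometry of points in a simplex. There the residue of `x` with respect to `y ≠ x` is the point where
the ray from `y` through `x` leaves the simplex, and `kappa` is the least ratio `x i / y i` over the
support of `y`. `FaceTest` then says that all supports coincide.

The invariant of the recursion is: `K` linearly independent points in a face with `K` vertices.
Almost surely `Q` avoids the finitely many hyperplanes on which two of these ratios tie, so the ray
from `S₁` through `Q` leaves through the interior of one facet; by continuity the residues do too
for large `n`, and the loop stops (`exists_faceTest`). Whenever it stops, equal supports put all
residues in a common facet, still linearly independent (`exists_facet_of_faceTest`), which restores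
the invariant. By induction the recursive call returns the vertices of that facet, and the
multi-sample residue of the average is the one vertex left. For the initial draws, full rank makes
`L` of them almost surely independent, each avoiding the span of the others already drawn. -/

noncomputable section

namespace Demixing

/-! ### Null sets of the uniform law on a convex hull. -/

section HullLaw

variable {V : Type*} [AddCommGroup V] [Module ℝ V] {ι : Type*} [Finite ι]

/-- `hullPoint S` as an affine map. -/
def hullMap (S : ι → V) : (Fin (hullDim S) → ℝ) →ᵃ[ℝ] V :=
  ((vectorSpan ℝ (Set.range S)).subtype ∘ₗ
    (Module.finBasis ℝ (vectorSpan ℝ (Set.range S))).equivFun.symm.toLinearMap).toAffineMap +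
      AffineMap.const ℝ _ (Classical.epsilon (fun p : V => p ∈ Set.range S))

theorem coe_hullMap (S : ι → V) : ⇑(hullMap S) = hullPoint S := rfl

theorem exists_hullPoint_eq (S : ι → V) (i : ι) : ∃ t, hullPoint S t = S i := by
  have hpS : Classical.epsilon (fun p : V => p ∈ Set.range S) ∈ Set.range S :=
    Classical.epsilon_spec (p := fun p : V => p ∈ Set.range S) ⟨S i, Set.mem_range_self i⟩
  refine ⟨(Module.finBasis ℝ (vectorSpan ℝ (Set.range S))).equivFun
    ⟨_, vsub_mem_vectorSpan ℝ (Set.mem_range_self i) hpS⟩, ?_⟩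
  simp only [hullPoint, LinearEquiv.symm_apply_apply]
  simp

theorem hullLaw_absolutelyContinuous (S : ι → V) : hullLaw S ≪ volume :=
  ProbabilityTheory.cond_absolutelyContinuous

theorem ae_hullPoint_mem_convexHull (S : ι → V) :
    ∀ᵐ t ∂hullLaw S, hullPoint S t ∈ convexHull ℝ (Set.range S) := by
  have hconv : Convex ℝ (hullPoint S ⁻¹' convexHull ℝ (Set.range S)) :=
    (convex_convexHull ℝ (Set.range S)).affine_preimage (hullMap S)
  exact Measure.ae_smul_measure (ae_restrict_mem₀ (hconv.nullMeasurableSet volume)) _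

/-- A linear functional that does not vanish at all of the points `S i` almost surely does not
vanish at a uniformly distributed element of their convex hull. -/
theorem ae_hullPoint_ne_zero (S : ι → V) (φ : V →ₗ[ℝ] ℝ) (h : ∃ i, φ (S i) ≠ 0) :
    ∀ᵐ t ∂hullLaw S, φ (hullPoint S t) ≠ 0 := by
  obtain ⟨i, hi⟩ := h
  obtain ⟨t₀, ht₀⟩ := exists_hullPoint_eq S i
  suffices h : ∀ᵐ t, φ (hullPoint S t) ≠ 0 from (hullLaw_absolutelyContinuous S).ae_le h
  -- In coordinates the zero set of `φ` is an affine subspace that misses `t₀`; a proper affine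
  -- subspace is Lebesgue null.
  have hker : AffineSubspace.comap (hullMap S) (LinearMap.ker φ).toAffineSubspace ≠ ⊤ := by
    intro htop
    have hmem : t₀ ∈ AffineSubspace.comap (hullMap S) (LinearMap.ker φ).toAffineSubspace := by
      rw [htop]; trivial
    rw [AffineSubspace.mem_comap, coe_hullMap, ht₀] at hmem
    exact hi hmem
  have := Measure.addHaar_affineSubspace volume _ hker
  rw [ae_iff]
  convert this using 2
  ext t
  simp [coe_hullMap]

end HullLaw

/-! ### `kappa` and residues in simplex coordinates. -/

theorem residue_map {𝒳 : Type*} [MeasurableSpace 𝒳] {ι : Type*}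
    (Φ : (ι → ℝ) →ₗ[ℝ] SignedMeasure 𝒳)
    (x y : ι → ℝ) :
    residue (Φ x) (Φ y) =
      Φ ((1 - kappa (Φ x) (Φ y))⁻¹ • (x - kappa (Φ x) (Φ y) • y)) := by
  rw [map_smul, map_sub, map_smul, residue]

section Simplex

variable {𝒳 : Type*} [MeasurableSpace 𝒳] {ι : Type*} [Fintype ι]

/-- An injective linear parametrization under which the distributions in the image correspond
exactly to the standard simplex. -/
structure IsSimplexParam (Φ : (ι → ℝ) →ₗ[ℝ] SignedMeasure 𝒳) : Prop where
  injective : Function.Injective Φ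
  isDistribution_iff : ∀ x, IsDistribution (Φ x) ↔ x ∈ stdSimplex ℝ ι

variable {Φ : (ι → ℝ) →ₗ[ℝ] SignedMeasure 𝒳}

theorem div_sub_mem_stdSimplex {x y : ι → ℝ} {κ : ℝ} (hx : x ∈ stdSimplex ℝ ι)
    (hy : y ∈ stdSimplex ℝ ι) (hκ : κ < 1) (hle : ∀ i, κ * y i ≤ x i) :
    (1 - κ)⁻¹ • (x - κ • y) ∈ stdSimplex ℝ ι := by
  have h1 : 0 < 1 - κ := sub_pos.2 hκ
  refine ⟨fun i => ?_, ?_⟩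
  · have := hle i
    simp only [Pi.smul_apply, Pi.sub_apply, smul_eq_mul]
    exact mul_nonneg (inv_nonneg.2 h1.le) (sub_nonneg.2 this)
  · simp only [Pi.smul_apply, Pi.sub_apply, smul_eq_mul]
    rw [← Finset.mul_sum, Finset.sum_sub_distrib, ← Finset.mul_sum, hx.2, hy.2, mul_one,
      inv_mul_cancel₀ h1.ne']

/-- Optimality certificate: the constraint at `i` is tight, so a larger weight would make coordinate
`i` of the remainder negative. The weight 1 would force `x = y`, as both have total mass 1. -/
theorem IsSimplexParam.kappa_eq (hΦ : IsSimplexParam Φ) {x y : ι → ℝ} {κ : ℝ}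
    (hx : x ∈ stdSimplex ℝ ι) (hy : y ∈ stdSimplex ℝ ι) (hne : x ≠ y) (hκ : 0 ≤ κ)
    (hle : ∀ i, κ * y i ≤ x i) {i : ι} (hi : 0 < y i) (hxi : x i = κ * y i) :
    kappa (Φ x) (Φ y) = κ ∧ κ < 1 := by
  have hle1 : κ ≤ 1 := by
    have := Finset.sum_le_sum fun i (_ : i ∈ Finset.univ) => hle i
    rwa [← Finset.mul_sum, hx.2, hy.2, mul_one] at this
  have hne1 : κ ≠ 1 := by
    rintro rfl
    have hs : ∑ i, y i = ∑ i, x i := hy.2.trans hx.2.symm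
    rw [Finset.sum_eq_sum_iff_of_le fun i _ => by simpa using hle i] at hs
    exact hne (funext fun i => (hs i (Finset.mem_univ i)).symm)
  have hlt : κ < 1 := lt_of_le_of_ne hle1 hne1
  refine ⟨IsGreatest.csSup_eq ⟨⟨⟨hκ, hle1⟩, Φ ((1 - κ)⁻¹ • (x - κ • y)),
    (hΦ.isDistribution_iff _).2 (div_sub_mem_stdSimplex hx hy hlt hle), ?_⟩, ?_⟩, hlt⟩
  · rw [map_smul, smul_smul, mul_inv_cancel₀ (sub_pos.2 hlt).ne', one_smul, map_sub, map_smul,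
      sub_add_cancel]
  · rintro κ' ⟨⟨-, hκ'1⟩, G, hG, hxG⟩
    rcases hκ'1.eq_or_lt with rfl | hκ'1
    · refine absurd (hΦ.injective ?_) hne
      simpa using hxG
    have h1 : 0 < 1 - κ' := sub_pos.2 hκ'1
    have hGx : G = Φ ((1 - κ')⁻¹ • (x - κ' • y)) := by
      rw [map_smul, map_sub, map_smul, hxG, add_sub_cancel_right, smul_smul,
        inv_mul_cancel₀ h1.ne', one_smul]
    rw [hGx, hΦ.isDistribution_iff] at hG
    have h2 := hG.1 i
    simp only [Pi.smul_apply, Pi.sub_apply, smul_eq_mul] at h2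
    have h3 := (mul_nonneg_iff_of_pos_left (inv_pos.2 h1)).1 h2
    rw [hxi] at h3
    exact le_of_mul_le_mul_right (sub_nonneg.1 h3) hi

theorem exists_pos_of_mem_stdSimplex {y : ι → ℝ} (hy : y ∈ stdSimplex ℝ ι) : ∃ i, 0 < y i := by
  by_contra! h
  have := Finset.sum_nonpos fun i (_ : i ∈ Finset.univ) => h i
  rw [hy.2] at this
  linarith

/-- The index `i` minimizes `x i / y i` over the support of `y`: it is the coordinate that vanishes
first when moving from `y` through `x`. -/
theorem IsSimplexParam.exists_kappa (hΦ : IsSimplexParam Φ) {x y : ι → ℝ}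
    (hx : x ∈ stdSimplex ℝ ι) (hy : y ∈ stdSimplex ℝ ι) (hne : x ≠ y) :
    ∃ i, 0 < y i ∧ kappa (Φ x) (Φ y) = x i / y i ∧ x i / y i < 1 ∧
      ∀ j, x i / y i * y j ≤ x j := by
  classical
  obtain ⟨i₀, hi₀⟩ := exists_pos_of_mem_stdSimplex hy
  obtain ⟨i, hi, hmin⟩ := Finset.exists_min_image (Finset.univ.filter fun i => 0 < y i)
    (fun i => x i / y i) ⟨i₀, by simpa using hi₀⟩
  replace hi : 0 < y i := by simpa using hi
  have hle : ∀ j, x i / y i * y j ≤ x j := by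
    intro j
    rcases (hy.1 j).eq_or_lt with h0 | h0
    · rw [← h0, mul_zero]; exact hx.1 j
    · exact (le_div_iff₀ h0).1 (hmin j (by simpa using h0))
  have h := hΦ.kappa_eq hx hy hne (div_nonneg (hx.1 i) hi.le) hle hi
    (div_mul_cancel₀ _ hi.ne').symm
  exact ⟨i, hi, h.1, h.2, hle⟩

theorem IsSimplexParam.kappa_self (hΦ : IsSimplexParam Φ) {x : ι → ℝ}
    (hx : x ∈ stdSimplex ℝ ι) : kappa (Φ x) (Φ x) = 1 :=
  IsGreatest.csSup_eq ⟨⟨⟨zero_le_one, le_rfl⟩, Φ x, (hΦ.isDistribution_iff _).2 hx, by simp⟩,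
    fun _ h => h.1.2⟩

/-- A minimum of finitely many ratios is positive exactly when each is. Applied to all pairs, this
turns `FaceTest` into equality of supports. -/
theorem IsSimplexParam.kappa_pos_iff (hΦ : IsSimplexParam Φ) {x y : ι → ℝ}
    (hx : x ∈ stdSimplex ℝ ι) (hy : y ∈ stdSimplex ℝ ι) :
    0 < kappa (Φ x) (Φ y) ↔ ∀ i, 0 < y i → 0 < x i := by
  by_cases hne : x = y
  · subst hne
    simp [hΦ.kappa_self hx]
  obtain ⟨i, hi, hk, -, hle⟩ := hΦ.exists_kappa hx hy hne
  rw [hk]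
  refine ⟨fun h j hj => (mul_pos h hj).trans_le (hle j), fun h => div_pos (h i hi) hi⟩

/-- The multi-sample residue with respect to all vertices but one of a face is the remaining
vertex. -/
theorem IsSimplexParam.multiResidue_eq [DecidableEq ι] (hΦ : IsSimplexParam Φ)
    (ρ : MaximizerRule 𝒳) {k : ℕ} {x : ι → ℝ} (hx : x ∈ stdSimplex ℝ ι) {σ : Fin k → ι}
    (hσ : Function.Injective σ) {j : ι} (hj : ∀ i, σ i ≠ j)
    (hsupp : ∀ l, l ≠ j → l ∉ Set.range σ → x l = 0) (hxj : 0 < x j) :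
    multiResidue ρ (Φ x) (fun i => Φ (Pi.single (σ i) 1)) = Φ (Pi.single j 1) := by
  have hdecomp : x = x j • Pi.single j 1 + ∑ i, x (σ i) • Pi.single (σ i) (1 : ℝ) := by
    funext l
    simp only [Pi.add_apply, Pi.smul_apply, Finset.sum_apply, smul_eq_mul, Pi.single_apply,
      mul_ite, mul_one, mul_zero]
    by_cases hl : l = j
    · subst hl
      simp [fun i => (hj i).symm]
    · by_cases hr : l ∈ Set.range σ
      · obtain ⟨i, rfl⟩ := hr
        simp [hl, hσ.eq_iff]
      · rw [hsupp l hl hr, if_neg hl, Finset.sum_eq_zero, add_zero]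
        intro i _
        rw [if_neg fun h => hr ⟨i, h.symm⟩]
  have hsum : x j + ∑ i, x (σ i) = 1 := by
    have h := hx.2
    conv_lhs at h => rw [hdecomp]
    simp only [Pi.add_apply, Pi.smul_apply, Finset.sum_apply, smul_eq_mul, Pi.single_apply,
      mul_ite, mul_one, mul_zero, Finset.sum_add_distrib] at h
    rw [Finset.sum_comm] at h
    simpa using h
  have hfeas : IsFeasible (Φ x) (fun i => Φ (Pi.single (σ i) 1)) fun i => x (σ i) := by
    refine ⟨fun i => hx.1 _, by linarith, Φ (Pi.single j 1),
      (hΦ.isDistribution_iff _).2 (single_mem_stdSimplex ℝ j), ?_⟩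
    conv_lhs => rw [hdecomp]
    rw [← hsum, add_sub_cancel_right]
    simp only [map_add, map_sum, map_smul]
  -- Every feasible weight is bounded coordinate by coordinate, and the bounds are attained
  -- together. Hence the maximizer is unique and the rule `ρ` has no freedom.
  have hbound : ∀ ν, IsFeasible (Φ x) (fun i => Φ (Pi.single (σ i) 1)) ν →
      ∀ i, ν i ≤ x (σ i) := by
    rintro ν ⟨hν, hν1, G, hG, hxG⟩ i
    have hy : ∀ l, (∑ i, ν i • Pi.single (σ i) (1 : ℝ)) l = ∑ i, if l = σ i then ν i else 0 := by
      intro l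
      simp [Pi.single_apply]
    have hmap : ∑ i, ν i • Φ (Pi.single (σ i) 1) = Φ (∑ i, ν i • Pi.single (σ i) (1 : ℝ)) := by
      simp
    rw [hmap] at hxG
    -- Total weight 1 would make `x` a mixture of the vertices `σ i`, with no mass at `j`.
    have h1 : 0 < 1 - ∑ i, ν i := by
      refine lt_of_le_of_ne (sub_nonneg.2 hν1) fun h0 => ?_
      rw [← h0, zero_smul, zero_add] at hxG
      have := hy j
      rw [← hΦ.injective hxG] at this
      simp only [fun i => (hj i).symm, if_false, Finset.sum_const_zero] at this
      exact hxj.ne' this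
    set s := 1 - ∑ i, ν i
    have hGx : G = Φ (s⁻¹ • (x - ∑ i, ν i • Pi.single (σ i) (1 : ℝ))) := by
      rw [map_smul, map_sub, hxG, add_sub_cancel_right, smul_smul,
        inv_mul_cancel₀ h1.ne', one_smul]
    rw [hGx, hΦ.isDistribution_iff] at hG
    have h2 := hG.1 (σ i)
    rw [Pi.smul_apply, Pi.sub_apply, hy, smul_eq_mul] at h2
    have h3 := (mul_nonneg_iff_of_pos_left (inv_pos.2 h1)).1 h2
    simpa [hσ.eq_iff] using h3
  have hmax := ρ.isMaximizer (Φ x) (fun i => Φ (Pi.single (σ i) 1))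
    ⟨_, hfeas, fun ν hν => Finset.sum_le_sum fun i _ => hbound ν hν i⟩
  have hw : ∀ i, ρ.weights (Φ x) (fun i => Φ (Pi.single (σ i) 1)) i = x (σ i) := by
    have hle := hbound _ hmax.1
    have heq := le_antisymm (Finset.sum_le_sum fun i (_ : i ∈ Finset.univ) => hle i)
      (hmax.2 _ hfeas)
    rw [Finset.sum_eq_sum_iff_of_le fun i _ => hle i] at heq
    exact fun i => heq i (Finset.mem_univ i)
  rw [multiResidue]
  simp only [hw]
  have hΦx : Φ x = x j • Φ (Pi.single j 1) + ∑ i, x (σ i) • Φ (Pi.single (σ i) 1) := by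
    conv_lhs => rw [hdecomp]
    simp only [map_add, map_sum, map_smul]
  rw [← eq_sub_of_add_eq hsum, hΦx, add_sub_cancel_right, smul_smul, inv_mul_cancel₀ hxj.ne', one_smul]

end Simplex

/-! ### Independent points spanning a face. -/

section Face

variable {ι : Type*} [Finite ι] [DecidableEq ι]

/-- Linearly independent vectors supported in `A`, as many as `A` has elements, span all vectors
supported in `A`. -/
theorem single_mem_span_range {K : ℕ} {s : Fin K → ι → ℝ} (hs : LinearIndependent ℝ s)
    {A : Finset ι} (hA : A.card = K) (hsupp : ∀ i, ∀ l ∉ A, s i l = 0) {l : ι} (hl : l ∈ A) :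
    Pi.single l (1 : ℝ) ∈ Submodule.span ℝ (Set.range s) := by
  have hind : LinearIndependent ℝ fun l : A => (Pi.single (l : ι) (1 : ℝ) : ι → ℝ) :=
    (Pi.linearIndependent_single_one ι ℝ).comp _ Subtype.val_injective
  have hle : Submodule.span ℝ (Set.range s) ≤
      Submodule.span ℝ (Set.range fun l : A => (Pi.single (l : ι) (1 : ℝ) : ι → ℝ)) := by
    rw [Submodule.span_le]
    rintro _ ⟨i, rfl⟩
    have : s i = ∑ l : A, s i l • (Pi.single (l : ι) (1 : ℝ) : ι → ℝ) := by
      funext m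
      simp only [Finset.sum_apply, Pi.smul_apply, smul_eq_mul, Pi.single_apply, mul_ite, mul_one,
        mul_zero]
      rw [Finset.sum_coe_sort A fun l => if m = l then s i l else 0]
      by_cases hm : m ∈ A
      · simp [hm]
      · simp [hm, hsupp i m hm]
    rw [this]
    exact Submodule.sum_mem _ fun l _ => Submodule.smul_mem _ _
      (Submodule.subset_span (Set.mem_range_self l))
  rw [Submodule.eq_of_le_of_finrank_eq hle]
  · exact Submodule.subset_span ⟨⟨l, hl⟩, rfl⟩
  · rw [finrank_span_eq_card hs, finrank_span_eq_card hind, Fintype.card_fin, Fintype.card_coe, hA]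

/-- A functional killing all `s i` kills their span, which contains every vertex of the face. This
yields both the genericity of `Q` and the positive mass of the average at the last vertex. -/
theorem exists_map_ne_zero {K : ℕ} {s : Fin K → ι → ℝ} (hs : LinearIndependent ℝ s)
    {A : Finset ι} (hA : A.card = K) (hsupp : ∀ i, ∀ l ∉ A, s i l = 0) {l : ι} (hl : l ∈ A)
    (φ : (ι → ℝ) →ₗ[ℝ] ℝ) (hφ : φ (Pi.single l 1) ≠ 0) : ∃ i, φ (s i) ≠ 0 := by
  by_contra! h
  refine hφ ?_
  have hle : Submodule.span ℝ (Set.range s) ≤ LinearMap.ker φ := by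
    rw [Submodule.span_le]
    rintro _ ⟨i, rfl⟩
    exact h i
  exact hle (single_mem_span_range hs hA hsupp hl)

end Face

/-! ### Leaving the simplex through a facet. -/

section Simplex

variable {𝒳 : Type*} [MeasurableSpace 𝒳] {ι : Type*}

/-- The coordinates of `Residue(Φ x | Φ y)`. -/
def residueCoords (Φ : (ι → ℝ) →ₗ[ℝ] SignedMeasure 𝒳) (x y : ι → ℝ) : ι → ℝ :=
  (1 - kappa (Φ x) (Φ y))⁻¹ • (x - kappa (Φ x) (Φ y) • y)

variable [Fintype ι] {Φ : (ι → ℝ) →ₗ[ℝ] SignedMeasure 𝒳}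

theorem IsSimplexParam.residueCoords_spec (hΦ : IsSimplexParam Φ) {x y : ι → ℝ}
    (hx : x ∈ stdSimplex ℝ ι) (hy : y ∈ stdSimplex ℝ ι) (hne : x ≠ y) :
    kappa (Φ x) (Φ y) < 1 ∧ residueCoords Φ x y ∈ stdSimplex ℝ ι ∧
      ∃ l, 0 < y l ∧ residueCoords Φ x y l = 0 := by
  obtain ⟨i, hi, hk, h1, hle⟩ := hΦ.exists_kappa hx hy hne
  rw [← hk] at h1 hle
  refine ⟨h1, div_sub_mem_stdSimplex hx hy h1 hle, i, hi, ?_⟩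
  simp [residueCoords, hk, div_mul_cancel₀ _ hi.ne']

/-- If `x` leaves the simplex through the facet opposite to the vertex `j` when moving away from
`y`, then the residue is in the relative interior of that facet. -/
theorem IsSimplexParam.residueCoords_pos_iff (hΦ : IsSimplexParam Φ) {x y : ι → ℝ}
    (hx : x ∈ stdSimplex ℝ ι) (hy : y ∈ stdSimplex ℝ ι) (hne : x ≠ y) {A : Finset ι}
    (hxA : ∀ l ∉ A, x l = 0) (hyA : ∀ l ∉ A, y l = 0) {j : ι} (hj : 0 < y j)
    (hlt : ∀ l ∈ A, l ≠ j → x j * y l < x l * y j) (l : ι) :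
    0 < residueCoords Φ x y l ↔ l ∈ A ∧ l ≠ j := by
  have hmul : ∀ l, x j / y j * y l = x j * y l / y j := fun l => div_mul_eq_mul_div _ _ _
  have hle : ∀ l, x j / y j * y l ≤ x l := by
    intro l
    rw [hmul, div_le_iff₀ hj]
    by_cases hl : l ∈ A
    · by_cases hlj : l = j
      · rw [hlj]
      · exact (hlt l hl hlj).le
    · simp [hxA l hl, hyA l hl]
  obtain ⟨hk, h1⟩ := hΦ.kappa_eq hx hy hne (div_nonneg (hx.1 j) hj.le) hle hj
    (div_mul_cancel₀ _ hj.ne').symm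
  simp only [residueCoords, hk, Pi.smul_apply, Pi.sub_apply, smul_eq_mul]
  rw [mul_pos_iff_of_pos_left (inv_pos.2 (sub_pos.2 h1)), sub_pos, hmul, div_lt_iff₀ hj]
  refine ⟨fun h => ⟨by_contra fun hl => ?_, ?_⟩, fun h => hlt l h.1 h.2⟩
  · simp [hxA l hl, hyA l hl] at h
  · rintro rfl
    exact h.ne rfl

omit [Fintype ι] in
/-- Residues of points `s (i + 1) / n + (n - 1) / n * q`, with `q` a convex combination of the
`s (i + 1)`, with respect to `s 0`. -/
theorem linearIndependent_residues {k : ℕ} {s : Fin (k + 1) → ι → ℝ}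
    (hs : LinearIndependent ℝ s) {w : Fin k → ℝ} (hw : ∑ i, w i = 1) {n : ℝ} (hn : n ≠ 0)
    {a κ : Fin k → ℝ} (ha : ∀ i, a i ≠ 0) :
    LinearIndependent ℝ fun i : Fin k => a i •
      ((1 / n) • s i.succ + ((n - 1) / n) • ∑ l, w l • s l.succ - κ i • s 0) := by
  rw [Fintype.linearIndependent_iff] at hs ⊢
  intro c hc
  set C := ∑ i, c i * a i with hC
  have h0 := hs (Fin.cons (-∑ i, c i * a i * κ i)
    fun l => c l * a l * (1 / n) + C * ((n - 1) / n) * w l) (by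
      rw [Fin.sum_univ_succ]
      simp only [Fin.cons_zero, Fin.cons_succ]
      rw [← hc]
      simp only [smul_sub, smul_add, Finset.smul_sum, smul_smul, Finset.sum_sub_distrib,
        Finset.sum_add_distrib, add_smul]
      rw [Finset.sum_comm]
      simp only [← Finset.sum_smul, neg_smul]
      rw [hC]
      simp only [Finset.sum_mul]
      simp only [mul_assoc, neg_add_eq_sub])
  have h1 : ∀ l, c l * a l * (1 / n) + C * ((n - 1) / n) * w l = 0 := fun l => by
    simpa using h0 l.succ
  -- Since the `w l` sum to 1, adding the relations `h1` over `l` gives `C / n + C * (n - 1) / n =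
  -- C`.
  have hC0 : C = 0 := by
    have := Finset.sum_congr rfl fun l (_ : l ∈ Finset.univ) => h1 l
    rw [Finset.sum_add_distrib, ← Finset.sum_mul, ← Finset.mul_sum, hw, ← hC,
      Finset.sum_const_zero] at this
    have hn1 : 1 / n + (n - 1) / n = 1 := by field_simp; ring
    rw [mul_one, ← mul_add, hn1, mul_one] at this
    exact this
  intro i
  have h2 := h1 i
  rw [hC0, zero_mul, zero_mul, add_zero] at h2
  simpa [ha i, hn] using h2

/-- A point of a face avoiding the hyperplanes `x l * y j = x j * y l` leaves the face through the
relative interior of a facet when moving away from `y`. -/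
theorem exists_exit_facet {x y : ι → ℝ} (hx : ∀ l, 0 ≤ x l) (hy : y ∈ stdSimplex ℝ ι)
    {A : Finset ι} (hyA : ∀ l ∉ A, y l = 0)
    (hgen : ∀ l ∈ A, ∀ j ∈ A, l ≠ j → 0 < y j → x l * y j ≠ x j * y l) :
    ∃ j ∈ A, 0 < y j ∧ ∀ l ∈ A, l ≠ j → x j * y l < x l * y j := by
  classical
  obtain ⟨i₀, hi₀⟩ := exists_pos_of_mem_stdSimplex hy
  have hmem : ∀ l, 0 < y l → l ∈ A := fun l hl => by_contra fun h => hl.ne' (hyA l h)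
  obtain ⟨j, hj, hmin⟩ := Finset.exists_min_image (Finset.univ.filter fun i => 0 < y i)
    (fun i => x i / y i) ⟨i₀, by simpa using hi₀⟩
  replace hj : 0 < y j := by simpa using hj
  -- Minimality gives the weak inequality and `hgen` makes it strict. Where `y l = 0`, genericity
  -- means `x l ≠ 0`.
  refine ⟨j, hmem j hj, hj, fun l hl hlj => lt_of_le_of_ne ?_ (hgen l hl j (hmem j hj) hlj hj).symm⟩
  rcases (hy.1 l).eq_or_lt with h0 | h0
  · rw [← h0, mul_zero]
    exact mul_nonneg (hx l) hj.le
  · exact (div_le_div_iff₀ hj h0).1 (hmin l (by simpa using h0))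

end Simplex

/-! ### One pass of the loop. -/

section Demix

variable {𝒳 : Type*} [MeasurableSpace 𝒳] {ι : Type*} [Fintype ι]
  {Φ : (ι → ℝ) →ₗ[ℝ] SignedMeasure 𝒳}

/-- The coordinates of `S_i / n + (n - 1) / n * Q`. -/
def loopMix (x q : ι → ℝ) (n : ℕ) : ι → ℝ :=
  (1 / (n : ℝ)) • x + (((n : ℝ) - 1) / n) • q

omit [Fintype ι] in
theorem loopResidues_eq {k : ℕ} (Φ : (ι → ℝ) →ₗ[ℝ] SignedMeasure 𝒳) (s : Fin (k + 1) → ι → ℝ)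
    (q : ι → ℝ) (n : ℕ) :
    loopResidues (fun i => Φ (s i)) (Φ q) n =
      fun i => Φ (residueCoords Φ (loopMix (s i.succ) q n) (s 0)) := by
  funext i
  rw [loopResidues, residueCoords, ← residue_map, loopMix, map_add, map_smul, map_smul]

theorem loopMix_mem {x q : ι → ℝ} (hx : x ∈ stdSimplex ℝ ι) (hq : q ∈ stdSimplex ℝ ι) {n : ℕ}
    (hn : 1 ≤ n) : loopMix x q n ∈ stdSimplex ℝ ι := by
  have hn' : (1 : ℝ) ≤ n := by exact_mod_cast hn
  refine convex_stdSimplex ℝ ι hx hq (by positivity)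
    (div_nonneg (by linarith) (by linarith)) ?_
  field_simp
  ring

omit [Fintype ι] in
theorem tendsto_loopMix (x q : ι → ℝ) (l : ι) :
    Filter.Tendsto (fun n : ℕ => loopMix x q n l) Filter.atTop (nhds (q l)) := by
  have h1 : Filter.Tendsto (fun n : ℕ => 1 / (n : ℝ)) Filter.atTop (nhds 0) :=
    tendsto_one_div_atTop_nhds_zero_nat
  have h2 : Filter.Tendsto (fun n : ℕ => 1 / (n : ℝ) * x l + (1 - 1 / (n : ℝ)) * q l)
      Filter.atTop (nhds (0 * x l + (1 - 0) * q l)) :=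
    (h1.mul_const _).add ((tendsto_const_nhds.sub h1).mul_const _)
  rw [zero_mul, zero_add, sub_zero, one_mul] at h2
  refine h2.congr' ?_
  filter_upwards [Filter.eventually_ge_atTop 1] with n hn
  have hn' : (n : ℝ) ≠ 0 := by positivity
  simp only [loopMix, Pi.add_apply, Pi.smul_apply, smul_eq_mul, sub_div, div_self hn']

omit [Fintype ι] in
-- The mixture lies in the span of the other points, which independence keeps away from `s 0`. This
-- excludes the degenerate residue with `kappa = 1`.
theorem loopMix_ne {k : ℕ} {s : Fin (k + 1) → ι → ℝ} (hs : LinearIndependent ℝ s) {q : ι → ℝ}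
    (hq : q ∈ Submodule.span ℝ (Set.range (Fin.tail s))) (i : Fin k) (n : ℕ) :
    loopMix (s i.succ) q n ≠ s 0 := by
  rw [linearIndependent_finSucc] at hs
  intro h
  refine hs.2 (h ▸ Submodule.add_mem _ (Submodule.smul_mem _ _ (Submodule.subset_span ⟨i, rfl⟩))
    (Submodule.smul_mem _ _ hq))

/-- By genericity `q` leaves through the interior of one facet, which is expressed by finitely many
strict inequalities. The mixtures tend to `q`, so for large `n` they satisfy the same inequalities
and all residues have the same support. -/
theorem exists_faceTest (hΦ : IsSimplexParam Φ) {k : ℕ} {s : Fin (k + 1) → ι → ℝ}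
    (hs : LinearIndependent ℝ s) (hmem : ∀ i, s i ∈ stdSimplex ℝ ι) {A : Finset ι}
    (hsA : ∀ i, ∀ l ∉ A, s i l = 0) {q : ι → ℝ} (hq : q ∈ stdSimplex ℝ ι)
    (hqs : q ∈ Submodule.span ℝ (Set.range (Fin.tail s))) (hqA : ∀ l ∉ A, q l = 0)
    (hgen : ∀ l ∈ A, ∀ j ∈ A, l ≠ j → 0 < s 0 j → q l * s 0 j ≠ q j * s 0 l) :
    ∃ n : ℕ, 2 ≤ n ∧ FaceTest (loopResidues (fun i => Φ (s i)) (Φ q) n) := by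
  obtain ⟨j, -, hj, hlt⟩ := exists_exit_facet hq.1 (hmem 0) (hsA 0) hgen
  have hev : ∀ᶠ n : ℕ in Filter.atTop, 2 ≤ n ∧ ∀ i : Fin k, ∀ l ∈ A, l ≠ j →
      loopMix (s i.succ) q n j * s 0 l < loopMix (s i.succ) q n l * s 0 j := by
    refine (Filter.eventually_ge_atTop 2).and ?_
    rw [Filter.eventually_all]
    intro i
    rw [Filter.eventually_all_finset]
    intro l hl
    by_cases hlj : l = j
    · exact Filter.Eventually.of_forall fun n h => absurd hlj h
    · filter_upwards [((tendsto_loopMix (s i.succ) q j).mul_const (s 0 l)).eventually_lt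
        ((tendsto_loopMix (s i.succ) q l).mul_const (s 0 j)) (hlt l hl hlj)] with n hn _ using hn
  obtain ⟨n, hn, hn'⟩ := hev.exists
  refine ⟨n, hn, ?_⟩
  have hm := fun i : Fin k => loopMix_mem (hmem i.succ) hq (one_le_two.trans hn)
  have hne := fun i : Fin k => loopMix_ne hs hqs i n
  have hpos := fun i : Fin k => hΦ.residueCoords_pos_iff (hm i) (hmem 0) (hne i) (A := A)
    (fun l hl => by simp [loopMix, hsA i.succ l hl, hqA l hl]) (hsA 0) hj (hn' i)
  have hR := fun i : Fin k => (hΦ.residueCoords_spec (hm i) (hmem 0) (hne i)).2.1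
  rw [loopResidues_eq]
  intro i i' _
  rw [hΦ.kappa_pos_iff (hR i) (hR i')]
  intro l hl
  rw [hpos] at hl ⊢
  exact hl

/-- When `FaceTest` is passed, the residues are linearly independent elements of the relative
interior of a common facet. -/
theorem exists_facet_of_faceTest (hΦ : IsSimplexParam Φ) [DecidableEq ι] {k : ℕ}
    {s : Fin (k + 2) → ι → ℝ}
    (hs : LinearIndependent ℝ s) (hmem : ∀ i, s i ∈ stdSimplex ℝ ι) {A : Finset ι}
    (hsA : ∀ i, ∀ l ∉ A, s i l = 0) {w : Fin (k + 1) → ℝ} (hw : ∑ i, w i = 1) {q : ι → ℝ}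
    (hqw : q = ∑ i, w i • s i.succ) (hq : q ∈ stdSimplex ℝ ι) {n : ℕ} (hn : 2 ≤ n)
    (hface : FaceTest (loopResidues (fun i => Φ (s i)) (Φ q) n)) :
    ∃ j ∈ A, ∃ r : Fin (k + 1) → ι → ℝ,
      loopResidues (fun i => Φ (s i)) (Φ q) n = (fun i => Φ (r i)) ∧ LinearIndependent ℝ r ∧
      (∀ i, r i ∈ stdSimplex ℝ ι) ∧ ∀ i, ∀ l ∉ A.erase j, r i l = 0 := by
  have hqs : q ∈ Submodule.span ℝ (Set.range (Fin.tail s)) := hqw ▸ Submodule.sum_mem _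
    fun i _ => Submodule.smul_mem _ _ (Submodule.subset_span ⟨i, rfl⟩)
  have hm := fun i => loopMix_mem (hmem (Fin.succ i)) hq (one_le_two.trans hn)
  have hne := fun i => loopMix_ne hs hqs i n
  have hspec := fun i => hΦ.residueCoords_spec (hm i) (hmem 0) (hne i)
  -- The facet is read off from the first residue. It need not be the one through which `q` leaves,
  -- since the loop may stop at a small `n`.
  obtain ⟨-, -, j, hj, hj0⟩ := hspec 0
  rw [loopResidues_eq] at hface ⊢
  refine ⟨j, by_contra fun h => hj.ne' (hsA 0 j h), _, rfl, ?_, fun i => (hspec i).2.1, ?_⟩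
  · have hn0 : (n : ℝ) ≠ 0 := by positivity
    rw [hqw]
    exact linearIndependent_residues hs hw hn0
      fun i => inv_ne_zero (sub_pos.2 (hqw ▸ (hspec i).1)).ne'
  · intro i l hl
    have hsuppA : ∀ l ∉ A, residueCoords Φ (loopMix (s i.succ) q n) (s 0) l = 0 := by
      intro l hl
      simp [residueCoords, loopMix, hsA _ l hl, hqw]
    by_cases hlA : l ∈ A
    · have hlj : l = j := by
        by_contra h
        exact hl (Finset.mem_erase.2 ⟨h, hlA⟩)
      subst hlj
      by_cases hi : i = 0
      · rw [hi]; exact hj0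
      · refine le_antisymm (not_lt.1 fun hpos => ?_) ((hspec i).2.1.1 l)
        have := (hΦ.kappa_pos_iff (hspec 0).2.1 (hspec i).2.1).1 (hface 0 i (Ne.symm hi)) l hpos
        exact this.ne' hj0
    · exact hsuppA l hlA

/-- For almost every draw of `Q`, the hypotheses of `exists_faceTest` hold. -/
theorem ae_hullPoint_generic (hΦ : IsSimplexParam Φ) [DecidableEq ι] {k : ℕ}
    {s : Fin (k + 1) → ι → ℝ}
    (hs : LinearIndependent ℝ s) (hmem : ∀ i, s i ∈ stdSimplex ℝ ι) {A : Finset ι}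
    (hA : A.card = k + 1) (hsA : ∀ i, ∀ l ∉ A, s i l = 0) :
    ∀ᵐ t ∂hullLaw (Fin.tail fun i => Φ (s i)), ∃ w : Fin k → ℝ, ∃ q : ι → ℝ,
      ∑ i, w i = 1 ∧ q = ∑ i, w i • s i.succ ∧ q ∈ stdSimplex ℝ ι ∧
      hullPoint (Fin.tail fun i => Φ (s i)) t = Φ q ∧
      ∀ l ∈ A, ∀ j ∈ A, l ≠ j → 0 < s 0 j → q l * s 0 j ≠ q j * s 0 l := by
  obtain ⟨Ψ, hΨ⟩ := LinearMap.exists_leftInverse_of_injective Φ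
    (LinearMap.ker_eq_bot.2 hΦ.injective)
  replace hΨ : ∀ x, Ψ (Φ x) = x := fun x => LinearMap.congr_fun hΨ x
  set S := Fin.tail fun i => Φ (s i) with hS
  have hgen : ∀ l ∈ A, ∀ j ∈ A, l ≠ j → 0 < s 0 j → ∀ᵐ t ∂hullLaw S,
      Ψ (hullPoint S t) l * s 0 j ≠ Ψ (hullPoint S t) j * s 0 l := by
    intro l hl j _ hlj hj
    -- `φ` is nonzero at the vertex `l`, hence at some `s i`. As it vanishes at `s 0`, that `s i` is
    -- one of the points from whose hull `Q` is drawn.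
    let φ : (ι → ℝ) →ₗ[ℝ] ℝ := s 0 j • LinearMap.proj l - s 0 l • LinearMap.proj j
    have hφ : ∀ x, φ x = s 0 j * x l - s 0 l * x j := fun x => rfl
    obtain ⟨i, hi⟩ := exists_map_ne_zero hs hA hsA hl φ (by simp [hφ, hlj.symm, hj.ne'])
    have hi0 : i ≠ 0 := by
      rintro rfl
      exact hi (by rw [hφ, mul_comm, sub_self])
    obtain ⟨i, rfl⟩ := Fin.exists_succ_eq.2 hi0
    have h := ae_hullPoint_ne_zero S (φ ∘ₗ Ψ) ⟨i, by
      rw [LinearMap.comp_apply, hS, Fin.tail, hΨ]; exact hi⟩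
    filter_upwards [h] with t ht heq
    refine ht ?_
    rw [LinearMap.comp_apply, hφ]
    linarith
  have hgen' : ∀ᵐ t ∂hullLaw S, ∀ l ∈ A, ∀ j ∈ A, l ≠ j → 0 < s 0 j →
      Ψ (hullPoint S t) l * s 0 j ≠ Ψ (hullPoint S t) j * s 0 l := by
    simpa only [ae_all_iff] using hgen
  filter_upwards [hgen', ae_hullPoint_mem_convexHull S] with t ht hmemt
  have himg : Set.range S = Φ '' Set.range (Fin.tail s) := by
    rw [← Set.range_comp]; rfl
  rw [himg, ← LinearMap.image_convexHull] at hmemt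
  obtain ⟨q, hq, hqt⟩ := hmemt
  have hqmem : q ∈ stdSimplex ℝ ι := convexHull_min (by rintro _ ⟨i, rfl⟩; exact hmem _)
    (convex_stdSimplex ℝ ι) hq
  rw [← hqt, hΨ] at ht
  obtain ⟨w, hw, hqw⟩ := eq_affineCombination_of_mem_affineSpan_of_fintype
    (convexHull_subset_affineSpan _ hq)
  rw [Finset.affineCombination_eq_linear_combination _ _ _ hw] at hqw
  exact ⟨w, q, hw, hqw, hqmem, hqt.symm, ht⟩

end Demix

/-! ### Induction on the dimension of the face. -/

section Demix

variable {𝒳 : Type*} [MeasurableSpace 𝒳] {ι : Type*} [Fintype ι] [DecidableEq ι]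
  {Φ : (ι → ℝ) →ₗ[ℝ] SignedMeasure 𝒳}

theorem eq_single_of_mem_stdSimplex {z : ι → ℝ} (hz : z ∈ stdSimplex ℝ ι) {c : ι}
    (h : ∀ l, l ≠ c → z l = 0) : z = Pi.single c 1 := by
  have hc : z c = 1 := by rw [← hz.2, Finset.sum_eq_single c (fun l _ hl => h l hl) (by simp)]
  funext l
  by_cases hl : l = c
  · rw [hl, hc, Pi.single_eq_same]
  · rw [h l hl, Pi.single_eq_of_ne hl]

/-- On an edge of the simplex, the residue of `x` with respect to `y ≠ x` is an end point. -/
theorem IsSimplexParam.residue_edge (hΦ : IsSimplexParam Φ) {x y : ι → ℝ}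
    (hx : x ∈ stdSimplex ℝ ι) (hy : y ∈ stdSimplex ℝ ι) (hne : x ≠ y) {A : Finset ι}
    (hA : A.card = 2) (hxA : ∀ l ∉ A, x l = 0) (hyA : ∀ l ∉ A, y l = 0) :
    ∃ l c, l ∈ A ∧ A.erase l = {c} ∧ x l < y l ∧
      residue (Φ x) (Φ y) = Φ (Pi.single c 1) := by
  obtain ⟨h1, hmem, l, hl, hl0⟩ := hΦ.residueCoords_spec hx hy hne
  have hlA : l ∈ A := by_contra fun h => hl.ne' (hyA l h)
  obtain ⟨c, hc⟩ := Finset.card_eq_one.1 (by rw [Finset.card_erase_of_mem hlA, hA])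
  refine ⟨l, c, hlA, hc, ?_, ?_⟩
  · simp only [residueCoords, Pi.smul_apply, Pi.sub_apply, smul_eq_mul] at hl0
    rcases mul_eq_zero.1 hl0 with h | h
    · exact absurd h (inv_ne_zero (sub_pos.2 h1).ne')
    · rw [sub_eq_zero.1 h]
      exact mul_lt_of_lt_one_left hl h1
  · rw [residue_map]
    refine congrArg Φ (eq_single_of_mem_stdSimplex hmem fun m hm => ?_)
    by_cases hmA : m ∈ A
    · by_cases hml : m = l
      · rw [hml]; exact hl0
      · have := Finset.mem_erase.2 ⟨hml, hmA⟩
        rw [hc, Finset.mem_singleton] at this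
        exact absurd this hm
    · simp [residueCoords, hxA m hmA, hyA m hmA]

theorem demixProb_two (hΦ : IsSimplexParam Φ) (ρ : MaximizerRule 𝒳) {s : Fin 2 → ι → ℝ}
    (hs : LinearIndependent ℝ s) (hmem : ∀ i, s i ∈ stdSimplex ℝ ι) {A : Finset ι}
    (hA : A.card = 2) (hsA : ∀ i, ∀ l ∉ A, s i l = 0) {E : Set (Fin 2 → SignedMeasure 𝒳)}
    (hE : ∀ σ : Fin 2 → ι, Function.Injective σ → (∀ i, σ i ∈ A) →
      (fun i => Φ (Pi.single (σ i) 1)) ∈ E) :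
    demixProb ρ 2 (fun i => Φ (s i)) E = 1 := by
  have hne : s 0 ≠ s 1 := hs.injective.ne (by decide)
  obtain ⟨l, c, hl, hc, hlt, hr⟩ := hΦ.residue_edge (hmem 0) (hmem 1) hne hA (hsA 0) (hsA 1)
  obtain ⟨l', c', hl', hc', hlt', hr'⟩ :=
    hΦ.residue_edge (hmem 1) (hmem 0) hne.symm hA (hsA 1) (hsA 0)
  -- If both residues were the same vertex, the same coordinate `l` would be lost in both, giving `s
  -- 0 l < s 1 l` and `s 1 l < s 0 l`.
  have hcc : c ≠ c' := by
    rintro rfl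
    have := (Finset.erase_inj A hl).1 (hc.trans hc'.symm)
    subst this
    exact lt_asymm hlt hlt'
  have hcA : c ∈ A := Finset.mem_of_mem_erase (hc ▸ Finset.mem_singleton_self c)
  have hcA' : c' ∈ A := Finset.mem_of_mem_erase (hc' ▸ Finset.mem_singleton_self c')
  rw [demixProb, if_pos]
  convert hE ![c, c'] ?_ ?_ using 1
  · funext i
    fin_cases i
    · exact hr
    · exact hr'
  · intro i j h
    fin_cases i <;> fin_cases j <;> simp_all
  · intro i
    fin_cases i <;> simpa

open Classical in
/-- `Demix`, run on linearly independent points of a face of the simplex with as many vertices,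
almost surely returns the vertices of this face in some order. -/
theorem demixProb_eq_one (hΦ : IsSimplexParam Φ) (ρ : MaximizerRule 𝒳) :
    ∀ (k : ℕ) {s : Fin (k + 2) → ι → ℝ}, LinearIndependent ℝ s →
      (∀ i, s i ∈ stdSimplex ℝ ι) → ∀ {A : Finset ι}, A.card = k + 2 →
      (∀ i, ∀ l ∉ A, s i l = 0) → ∀ {E : Set (Fin (k + 2) → SignedMeasure 𝒳)},
      (∀ σ : Fin (k + 2) → ι, Function.Injective σ → (∀ i, σ i ∈ A) →
        (fun i => Φ (Pi.single (σ i) 1)) ∈ E) →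
      demixProb ρ (k + 2) (fun i => Φ (s i)) E = 1
  | 0, _, hs, hmem, _, hA, hsA, _, hE => demixProb_two hΦ ρ hs hmem hA hsA hE
  | k + 1, s, hs, hmem, A, hA, hsA, E, hE => by
    have := isProbabilityMeasure_hullLaw (Fin.tail fun i => Φ (s i))
    rw [demixProb]
    refine (lintegral_congr_ae (g := fun _ => 1) ?_).trans (by simp)
    filter_upwards [ae_hullPoint_generic hΦ hs hmem hA hsA] with t ht
    obtain ⟨w, q, hw, hqw, hq, hqt, hgen⟩ := ht
    have hqs : q ∈ Submodule.span ℝ (Set.range (Fin.tail s)) := hqw ▸ Submodule.sum_mem _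
      fun i _ => Submodule.smul_mem _ _ (Submodule.subset_span ⟨i, rfl⟩)
    have hqA : ∀ l ∉ A, q l = 0 := fun l hl => by simp [hqw, hsA _ l hl]
    dsimp only
    rw [hqt]
    have hn := exists_faceTest hΦ hs hmem hsA hq hqs hqA hgen
    rw [dif_pos hn]
    obtain ⟨j, hj, r, hr, hrind, hrmem, hrA⟩ := exists_facet_of_faceTest hΦ hs hmem hsA hw hqw hq
      (Nat.find_spec hn).1 (Nat.find_spec hn).2
    rw [hr]
    have hcard : (A.erase j).card = k + 2 := by rw [Finset.card_erase_of_mem hj, hA]; rfl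
    refine demixProb_eq_one hΦ ρ k hrind hrmem hcard hrA fun σ hσ hσA => ?_
    have hσj : ∀ i, σ i ≠ j := fun i => (Finset.mem_erase.1 (hσA i)).1
    -- By counting, `σ` exhausts the facet, so `j` is the only vertex of `A` still missing.
    have himage : Finset.univ.image σ = A.erase j := by
      refine Finset.eq_of_subset_of_card_le ?_ ?_
      · intro l hl
        obtain ⟨i, -, rfl⟩ := Finset.mem_image.1 hl
        exact hσA i
      · rw [hcard, Finset.card_image_of_injective _ hσ, Finset.card_univ, Fintype.card_fin]
    have hpos : (0 : ℝ) < 1 / ((k : ℝ) + 3) := by positivity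
    set x : ι → ℝ := (1 / ((k : ℝ) + 3)) • ∑ i, s i with hx
    have hxmap : (1 / ((k : ℝ) + 3)) • ∑ i, Φ (s i) = Φ x := by
      rw [hx, map_smul, map_sum]
    have hxl : ∀ l, x l = (1 / ((k : ℝ) + 3)) * ∑ i, s i l := fun l => by simp [hx]
    have hxmem : x ∈ stdSimplex ℝ ι := by
      refine ⟨fun l => ?_, ?_⟩
      · rw [hxl]
        exact mul_nonneg hpos.le (Finset.sum_nonneg fun i _ => (hmem i).1 l)
      · simp only [hxl]
        rw [← Finset.mul_sum, Finset.sum_comm]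
        simp only [(hmem _).2, Finset.sum_const, Finset.card_univ, Fintype.card_fin, nsmul_eq_mul,
          mul_one]
        push_cast
        field_simp
        ring
    have hxj : 0 < x j := by
      obtain ⟨i, hi⟩ := exists_map_ne_zero hs hA hsA hj (LinearMap.proj j) (by simp)
      rw [hxl]
      exact mul_pos hpos (Finset.sum_pos' (fun i _ => (hmem i).1 j)
        ⟨i, Finset.mem_univ i, lt_of_le_of_ne ((hmem i).1 j) (Ne.symm hi)⟩)
    have hres : multiResidue ρ (Φ x) (fun i => Φ (Pi.single (σ i) 1)) = Φ (Pi.single j 1) := by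
      refine hΦ.multiResidue_eq ρ hxmem hσ hσj (fun l hlj hl => ?_) hxj
      have hlA : l ∉ A := by
        intro h
        have := Finset.mem_erase.2 ⟨hlj, h⟩
        rw [← himage, Finset.mem_image] at this
        obtain ⟨i, -, hi⟩ := this
        exact hl ⟨i, hi⟩
      rw [hxl, Finset.sum_eq_zero fun i _ => hsA i l hlA, mul_zero]
    rw [Set.mem_ofPred_eq, hxmap, hres]
    convert hE (Fin.snoc σ j) ?_ ?_ using 1
    · funext i
      refine Fin.lastCases ?_ (fun i => ?_) i <;> simp
    · rw [Fin.snoc_injective_iff]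
      exact ⟨hσ, fun ⟨i, hi⟩ => hσj i hi⟩
    · intro i
      refine Fin.lastCases ?_ (fun i => ?_) i
      · simpa using hj
      · simpa using (Finset.mem_erase.1 (hσA i)).2

end Demix

/-! ### Linear independence of the initial draws. -/

section Independence

variable {V : Type*} [AddCommGroup V] [Module ℝ V] {ι : Type*} [Finite ι] [Nonempty ι]
  {E : Type*} [NormedAddCommGroup E] [NormedSpace ℝ E]

/-- Independent uniformly distributed elements of the convex hull of spanning points are almost
surely linearly independent. -/
theorem ae_linearIndependent_hullPoint (S : ι → V) (Ψ : V →ₗ[ℝ] E)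
    (hspan : Submodule.span ℝ (Set.range fun i => Ψ (S i)) = ⊤) :
    ∀ k ≤ Module.finrank ℝ E, ∀ᵐ t ∂Measure.pi fun _ : Fin k => hullLaw S,
      LinearIndependent ℝ fun i => Ψ (hullPoint S (t i))
  | 0, _ => Filter.Eventually.of_forall fun _ => linearIndependent_empty_type
  | k + 1, hk => by
    have := isProbabilityMeasure_hullLaw S
    have hcont : Continuous fun t => Ψ (hullPoint S t) :=
      (Ψ.toAffineMap.comp (hullMap S)).continuous_of_finiteDimensional
    have hmp := measurePreserving_piFinSuccAbove (fun _ : Fin (k + 1) => hullLaw S) 0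
    -- Linear independence is an open condition; measurability is what Fubini needs below.
    have hmeas : MeasurableSet {p : (Fin (hullDim S) → ℝ) × (Fin k → Fin (hullDim S) → ℝ) |
        LinearIndependent ℝ (Fin.cons (Ψ (hullPoint S p.1))
          fun i => Ψ (hullPoint S (p.2 i)) : Fin (k + 1) → E)} := by
      refine (isOpen_setOfPred_linearIndependent.preimage ?_).measurableSet
      refine continuous_pi fun i => ?_
      refine Fin.cases ?_ (fun i => ?_) i
      · exact hcont.comp continuous_fst
      · exact hcont.comp ((continuous_apply i).comp continuous_snd)
    have hprod : ∀ᵐ p ∂(hullLaw S).prod (Measure.pi fun _ : Fin k => hullLaw S),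
        LinearIndependent ℝ (Fin.cons (Ψ (hullPoint S p.1))
          fun i => Ψ (hullPoint S (p.2 i)) : Fin (k + 1) → E) := by
      -- The order is swapped so that the other `k` draws are fixed first. Their span is proper, so
      -- it lies in the kernel of a nonzero functional, which cannot vanish at all of the spanning
      -- points.
      rw [Measure.ae_prod_iff_ae_ae hmeas, Measure.ae_ae_comm hmeas]
      filter_upwards [ae_linearIndependent_hullPoint S Ψ hspan k (Nat.le_of_succ_le hk)] with t ht
      have hlt : Submodule.span ℝ (Set.range fun i => Ψ (hullPoint S (t i))) < ⊤ := by
        refine lt_top_iff_ne_top.2 fun htop => ?_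
        have h := finrank_span_eq_card ht
        rw [htop, finrank_top, Fintype.card_fin] at h
        omega
      obtain ⟨φ, hφ, hle⟩ := Submodule.exists_le_ker_of_lt_top _ hlt
      have hex : ∃ i, (φ ∘ₗ Ψ) (S i) ≠ 0 := by
        by_contra! h
        refine hφ (LinearMap.ext_on_range hspan fun i => ?_)
        exact h i
      filter_upwards [ae_hullPoint_ne_zero S (φ ∘ₗ Ψ) hex] with t₀ ht₀
      exact linearIndependent_finCons.2 ⟨ht, fun hmem => ht₀ (hle hmem)⟩
    filter_upwards [hmp.quasiMeasurePreserving.ae hprod] with t ht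
    convert ht using 1
    funext i
    refine Fin.cases ?_ (fun i => ?_) i <;> rfl

end Independence

/-! ### From joint irreducibility to the simplex. -/

section Model

variable {𝒳 : Type*} [MeasurableSpace 𝒳]

theorem linearCombination_toSignedMeasure_apply {ι : Type*} [Fintype ι] (P : ι → Measure 𝒳)
    [∀ j, IsFiniteMeasure (P j)] (x : ι → ℝ) {B : Set 𝒳} (hB : MeasurableSet B) :
    Fintype.linearCombination ℝ (fun j => (P j).toSignedMeasure) x B =
      ∑ j, x j * (P j).real B := by
  rw [Fintype.linearCombination_apply]
  simp [Measure.toSignedMeasure_apply_measurable hB]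

/-- Jointly irreducible distributions are linearly independent, and the distributions in their
span are exactly their mixtures. -/
theorem JointlyIrreducible.isSimplexParam {L : ℕ} {P : Fin L → Measure 𝒳}
    [∀ j, IsProbabilityMeasure (P j)] (hL : 0 < L)
    (hP : JointlyIrreducible fun j => (P j).toSignedMeasure) :
    IsSimplexParam (Fintype.linearCombination ℝ fun j => (P j).toSignedMeasure) := by
  have huniv : ∀ x, Fintype.linearCombination ℝ (fun j => (P j).toSignedMeasure) x Set.univ =
      ∑ j, x j := fun x => by
    simp [linearCombination_toSignedMeasure_apply P x MeasurableSet.univ]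
  have hiff : ∀ x, IsDistribution (Fintype.linearCombination ℝ (fun j => (P j).toSignedMeasure) x) ↔
      x ∈ stdSimplex ℝ (Fin L) := by
    intro x
    refine ⟨fun h => ⟨hP x h, ?_⟩, fun h => ⟨fun B hB => ?_, ?_⟩⟩
    · rw [← huniv]; exact h.2
    · rw [linearCombination_toSignedMeasure_apply P x hB]
      exact Finset.sum_nonneg fun j _ => mul_nonneg (h.1 j) measureReal_nonneg
    · rw [huniv]; exact h.2
  refine ⟨(injective_iff_map_eq_zero _).2 fun x hx => ?_, hiff⟩
  let i₀ : Fin L := ⟨0, hL⟩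
  -- Adding multiples of a kernel vector `x` to a vertex does not change the distribution, so the
  -- coordinates stay nonnegative for every `c`. Taking `c = -2 / x i` below brings coordinate `i`
  -- down to at most `1 - 2 < 0`.
  have hnonneg : ∀ c : ℝ, ∀ i, 0 ≤ (Pi.single i₀ 1 + c • x : Fin L → ℝ) i := by
    intro c
    refine ((hiff _).1 ?_).1
    rw [map_add, map_smul, hx, smul_zero, add_zero]
    exact (hiff _).2 (single_mem_stdSimplex ℝ i₀)
  have hle1 : ∀ i, (Pi.single i₀ 1 : Fin L → ℝ) i ≤ 1 :=
    fun i => by by_cases h : i = i₀ <;> simp [h]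
  funext i
  by_contra h
  have h1 := hnonneg (-2 / x i) i
  have h2 := hle1 i
  rw [Pi.add_apply, Pi.smul_apply, smul_eq_mul, div_mul_cancel₀ _ h] at h1
  linarith

end Model

end Demixing

end

/-! ### Conclusion for `NonSquareDemix`. -/

theorem mainTheorem8 {𝒳 : Type*} [MeasurableSpace 𝒳] (L M : ℕ) (hL : 2 ≤ L) (hLM : L < M)
    (P : Fin L → Measure 𝒳) [∀ j, IsProbabilityMeasure (P j)]
    (hP : Demixing.JointlyIrreducible (fun j => (P j).toSignedMeasure))
    (Pi : Matrix (Fin M) (Fin L) ℝ)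
    (hPi_nonneg : ∀ i j, 0 ≤ Pi i j) (hPi_sum : ∀ i, ∑ j, Pi i j = 1)
    (hPi_rank : Pi.rank = L)
    (Ptilde : Fin M → Measure 𝒳) [∀ i, IsProbabilityMeasure (Ptilde i)]
    (hmodel : ∀ i, Ptilde i = ∑ j, ENNReal.ofReal (Pi i j) • P j)
    (ρ : Demixing.MaximizerRule 𝒳) :
    Demixing.nonSquareDemixProb ρ L (fun i => (Ptilde i).toSignedMeasure)
      {Q | ∃ σ : Equiv.Perm (Fin L), ∀ i, Q i = (P (σ i)).toSignedMeasure} = 1 := by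
  have hΦ := hP.isSimplexParam (by omega)
  set Φ := Fintype.linearCombination ℝ fun j => (P j).toSignedMeasure with hΦdef
  have hΦsingle : ∀ j, Φ (_root_.Pi.single j 1) = (P j).toSignedMeasure := fun j => by
    rw [hΦdef, Fintype.linearCombination_apply_single, one_smul]
  have hS : (fun i => (Ptilde i).toSignedMeasure) = fun i => Φ (Pi i) := by
    funext i
    ext B hB
    rw [Demixing.linearCombination_toSignedMeasure_apply P _ hB,
      Measure.toSignedMeasure_apply_measurable hB, measureReal_def, hmodel i,
      Measure.finsetSum_apply, ENNReal.toReal_sum fun j _ => by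
        rw [Measure.smul_apply, smul_eq_mul]; finiteness]
    simp [ENNReal.toReal_ofReal (hPi_nonneg i _), measureReal_def]
  obtain ⟨Ψ, hΨ⟩ := LinearMap.exists_leftInverse_of_injective Φ
    (LinearMap.ker_eq_bot.2 hΦ.injective)
  replace hΨ : ∀ x, Ψ (Φ x) = x := fun x => LinearMap.congr_fun hΨ x
  have : Nonempty (Fin M) := ⟨⟨0, by omega⟩⟩
  rw [hS, Demixing.nonSquareDemixProb]
  have := Demixing.isProbabilityMeasure_hullLaw fun i => Φ (Pi i)
  -- Rank `L` says that the rows of `Pi`, which are the coordinates of the mixtures, span the whole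
  -- coordinate space.
  have hspan : Submodule.span ℝ (Set.range fun i => Ψ (Φ (Pi i))) = ⊤ := by
    simp only [hΨ]
    refine Submodule.eq_top_of_finrank_eq ?_
    exact (Matrix.rank_eq_finrank_span_row Pi).symm.trans
      (hPi_rank.trans (Module.finrank_fin_fun ℝ).symm)
  have hind := Demixing.ae_linearIndependent_hullPoint (fun i => Φ (Pi i)) Ψ hspan L
    (Module.finrank_fin_fun ℝ).ge
  have hconv : ∀ᵐ t ∂Measure.pi fun _ : Fin L => Demixing.hullLaw fun i => Φ (Pi i),
      ∀ i, Demixing.hullPoint (fun i => Φ (Pi i)) (t i) ∈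
        convexHull ℝ (Set.range fun i => Φ (Pi i)) :=
    ae_all_iff.2 fun i => (Measure.tendsto_eval_ae_ae
      (μ := fun _ : Fin L => Demixing.hullLaw fun i => Φ (Pi i)) (i := i)).eventually
      (Demixing.ae_hullPoint_mem_convexHull fun i => Φ (Pi i))
  refine (lintegral_congr_ae (g := fun _ => 1) ?_).trans (by simp)
  filter_upwards [hind, hconv] with t ht hmem
  have hx : ∀ i, ∃ x ∈ stdSimplex ℝ (Fin L),
      Φ x = Demixing.hullPoint (fun i => Φ (Pi i)) (t i) := by
    intro i
    have h := hmem i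
    have himg : Set.range (fun i => Φ (Pi i)) = Φ '' Set.range fun i => Pi i := by
      rw [← Set.range_comp]; rfl
    rw [himg, ← LinearMap.image_convexHull] at h
    obtain ⟨x, hx, hxt⟩ := h
    refine ⟨x, convexHull_min ?_ (convex_stdSimplex ℝ _) hx, hxt⟩
    rintro _ ⟨i, rfl⟩
    exact ⟨hPi_nonneg i, hPi_sum i⟩
  choose s hs hst using hx
  simp only [← hst, hΨ] at ht ⊢
  obtain ⟨k, rfl⟩ := Nat.exists_eq_add_of_le' hL
  refine Demixing.demixProb_eq_one hΦ ρ k ht hs (A := Finset.univ) (by simp) (by simp)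
    fun σ hσ _ => ?_
  exact ⟨Equiv.ofBijective σ (Finite.injective_iff_bijective.1 hσ), fun i => hΦsingle _⟩
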